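/- For $\mu\in\mathbb{R}$ and $v>0$ let $N_{\mu,v}$ and $\Phi_{\mu,v}$ denote the density and the cumulative distribution function of the normal distribution with mean $\mu$ and variance $v$, and write $N=N_{0,1}$, $\Phi=\Phi_{0,1}$. For $s\in\mathbb{R}$ let $\mathcal{A}_s$ be the set of continuously differentiable, monotone increasing functions $A:\mathbb{R}\to[0,1]$ with $A(s)=1$ and $\Phi\le A\le 1$, and define $$Z_{v,s}(\mu)=1-\sup_{A\in\mathcal{A}_s}\left(\int_{\mathbb{R}}\sqrt{\tfrac{dA}{dx}(x)\,N_{\mu,v}(x)}\,dx\right)^2 .$$ Put $$I_{\mu,v}(x)=\sqrt{\tfrac{2\sqrt v}{1+v}}\;e^{-\frac{\mu^2}{4(1+v)}}\;\Phi_{\frac{\mu}{1+v},\frac{2v}{1+v}}(x),$$ and consider the following two equations in $x\in\mathbb{R}$: $$\text{(a)}\quad \frac{1-\Phi(x)}{\Phi_{\mu,v}(s)-\Phi_{\mu,v}(x)}=\frac{N(x)}{N_{\mu,v}(x)},\qquad \text{(b)}\quad \frac{\Phi(x)}{\Phi_{\mu,v}(x)}=\frac{N(x)}{N_{\mu,v}(x)}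 .$$ Then for all $\mu,s\in\mathbb{R}$ and $v>0$ the following hold. 1. If $0<v<1$, then (a) has a unique solution $\beta=\beta_{\mu,v,s}$, and $$Z_{v,s}(\mu)=1-\left(\sqrt{1-\Phi(\beta)}\sqrt{\Phi_{\mu,v}(s)-\Phi_{\mu,v}(\beta)}+I_{\mu,v}(\beta)\right)^2 .$$ 2. If $v=1$ and $\mu\le 0$, then $Z_{1,s}(\mu)=\Phi(\mu-s)$. If $v=1$ and $\mu>0$, then (a) has a unique solution $\beta=\beta_{\mu,1,s}$, and $$Z_{1,s}(\mu)=1-\left(\sqrt{1-\Phi(\beta)}\sqrt{\Phi(s-\mu)-\Phi(\beta-\mu)}+\Phi\!\left(\beta-\tfrac{\mu}{2}\right)e^{-\frac{\mu^2}{8}}\right)^2 .$$ 3. If $v>1$, then (b) has a unique solution $\alpha=\alpha_{\mu,v}$, and there is a unique real number $\tau=\Phi_{\mu,v}^{-1}\!\left(\Phi_{\mu,v}(\alpha)/\Phi(\alpha)\right)$; both depend only on $\mu$ and $v$. If $s\le\tau$, then $Z_{v,s}(\mu)=1-\Phi_{\mu,v}(s)$. If $s>\tau$, then (a) has exactly two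 solutions, only the larger of which, $\beta=\beta_{\mu,v,s}$, is larger than $\alpha$, and $$Z_{v,s}(\mu)=1-\left(\sqrt{\Phi(\alpha)\Phi_{\mu,v}(\alpha)}+I_{\mu,v}(\beta)-I_{\mu,v}(\alpha)+\sqrt{1-\Phi(\beta)}\sqrt{\Phi_{\mu,v}(s)-\Phi_{\mu,v}(\beta)}\right)^2 .$$ Moreover $I_{\mu,v}(\infty):=\lim_{x\to\infty}I_{\mu,v}(x)=\sqrt{\tfrac{2\sqrt v}{1+v}}\,e^{-\frac{\mu^2}{4(1+v)}}$. -/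

import Mathlib

open scoped NNReal

noncomputable section

/-- `N_{μ,v}`: the density of the normal distribution with mean `μ` and variance `v`. -/
def normalPDF (μ : ℝ) (v : ℝ≥0) (x : ℝ) : ℝ :=
  ProbabilityTheory.gaussianPDFReal μ v x

/-- `Φ_{μ,v}`: the cumulative distribution function of the normal distribution with mean `μ`
and variance `v`. -/
def normalCDF (μ : ℝ) (v : ℝ≥0) (x : ℝ) : ℝ :=
  ProbabilityTheory.cdf (ProbabilityTheory.gaussianReal μ v) x

/-- `N = N_{0,1}`. -/
def stdPDF (x : ℝ) : ℝ := normalPDF 0 1 x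

/-- `Φ = Φ_{0,1}`. -/
def stdCDF (x : ℝ) : ℝ := normalCDF 0 1 x

/-- The continuous fidelity (Bhattacharyya coefficient) `∫ √(p q)`. -/
def fidelity (p q : ℝ → ℝ) : ℝ := ∫ x, √(p x * q x)

/-- The set `𝒜_s` of continuously differentiable, monotone increasing functions `A` with
`A(s) = 1` and `Φ ≤ A ≤ 1` (so `A` takes values in `[0,1]`). -/
def admissibleSet (s : ℝ) : Set (ℝ → ℝ) :=
  {A | ContDiff ℝ 1 A ∧ Monotone A ∧ A s = 1 ∧ ∀ x, stdCDF x ≤ A x ∧ A x ≤ 1}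

/-- The generalized Rayleigh-normal distribution function `Z_{v,s}(μ)`. -/
def rayleighNormal (v : ℝ≥0) (s μ : ℝ) : ℝ :=
  1 - sSup ((fun A : ℝ → ℝ => fidelity (deriv A) (normalPDF μ v) ^ 2) '' admissibleSet s)

/-- The equation `(1 - Φ(x)) / (Φ_{μ,v}(s) - Φ_{μ,v}(x)) = N(x) / N_{μ,v}(x)` in `x`.
For `v > 0` the right side is positive, so `x = s` (where the denominator vanishes and the
quotient is `0` by convention) does not satisfy it. -/
def BetaEquation (μ : ℝ) (v : ℝ≥0) (s x : ℝ) : Prop :=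
  (1 - stdCDF x) / (normalCDF μ v s - normalCDF μ v x) = stdPDF x / normalPDF μ v x

/-- The equation `Φ(x) / Φ_{μ,v}(x) = N(x) / N_{μ,v}(x)` in `x`. -/
def AlphaEquation (μ : ℝ) (v : ℝ≥0) (x : ℝ) : Prop :=
  stdCDF x / normalCDF μ v x = stdPDF x / normalPDF μ v x

/-- `I_{μ,v}(x) = √(2√v/(1+v)) · exp(-μ²/(4(1+v))) · Φ_{μ/(1+v), 2v/(1+v)}(x)`. -/
def overlap (μ : ℝ) (v : ℝ≥0) (x : ℝ) : ℝ :=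
  √(2 * √(v : ℝ) / (1 + v)) * Real.exp (-(μ ^ 2 / (4 * (1 + v)))) *
    normalCDF (μ / (1 + v)) (2 * v / (1 + v)) x

end

section

open MeasureTheory Set Filter Topology ProbabilityTheory

/-! Write q = N_{μ,v}, Q = Φ_{μ,v}, r = N/q. For any weight ρ > 0, √(A' q) ≤ (A'/√ρ + √ρ q)/2, with
equality when A' = ρ q. So a distribution function above Φ with density ρ q on (-∞, s] is optimal
once every admissible A satisfies ∫ A'/√ρ ≤ ∫ √ρ q there (`sSup_fidelity_sq`). Such a candidate has
a density jump at s, so its value is approached through C¹ smoothings.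

The right ρ is continuous, equal to r where the constraint A ≥ Φ binds and constant elsewhere. Where
r is nonincreasing, 1/√r is nondecreasing, and integration by parts against A - Φ ≥ 0 gives the
required bound (`integral_deriv_div_sqrt_pdfRatio_le`). The pieces are glued at α and β, whose
equations say that the masses match. This yields three shapes: `rayleighNormal_eq_of_dominated`,
`rayleighNormal_eq_of_beta`, `rayleighNormal_eq_of_alpha_beta`.

Both equations are level conditions on G_c = 1 - Φ - r (c - Q) (`tailGap`): G_c = 0 with c = Q(s)
for β, G_0 = 1 for α. Since G_c' = -r' (c - Q), the roots are counted from the monotonicity of r,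
which changes only at μ/(1-v) when v ≠ 1. -/

/-! ### Gaussian densities and distribution functions. -/

theorem normalPDF_pos (μ : ℝ) {v : ℝ≥0} (hv : v ≠ 0) (x : ℝ) : 0 < normalPDF μ v x :=
  gaussianPDFReal_pos μ v x hv

theorem continuous_normalPDF (μ : ℝ) (v : ℝ≥0) : Continuous (normalPDF μ v) := by
  unfold normalPDF gaussianPDFReal
  fun_prop

theorem integrable_normalPDF (μ : ℝ) (v : ℝ≥0) : Integrable (normalPDF μ v) :=
  integrable_gaussianPDFReal μ v

theorem normalCDF_eq_integral (μ : ℝ) {v : ℝ≥0} (hv : v ≠ 0) (x : ℝ) :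
    normalCDF μ v x = ∫ t in Iic x, normalPDF μ v t := by
  rw [normalCDF, cdf_eq_real, measureReal_def, gaussianReal_apply_eq_integral μ hv,
    ENNReal.toReal_ofReal (integral_nonneg fun t => gaussianPDFReal_nonneg μ v t)]
  rfl

theorem integral_normalPDF_eq_sub (μ : ℝ) {v : ℝ≥0} (hv : v ≠ 0) (x y : ℝ) :
    ∫ t in x..y, normalPDF μ v t = normalCDF μ v y - normalCDF μ v x := by
  rw [normalCDF_eq_integral μ hv, normalCDF_eq_integral μ hv,
    intervalIntegral.integral_Iic_sub_Iic (integrable_normalPDF μ v).integrableOn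
      (integrable_normalPDF μ v).integrableOn]

theorem hasDerivAt_normalCDF (μ : ℝ) {v : ℝ≥0} (hv : v ≠ 0) (x : ℝ) :
    HasDerivAt (normalCDF μ v) (normalPDF μ v x) x := by
  have h : normalCDF μ v = fun y => (∫ t in (0 : ℝ)..y, normalPDF μ v t) + normalCDF μ v 0 := by
    funext y
    rw [integral_normalPDF_eq_sub μ hv]
    ring
  rw [h]
  exact ((continuous_normalPDF μ v).integral_hasStrictDerivAt 0 x).hasDerivAt.add_const _

theorem continuous_normalCDF (μ : ℝ) {v : ℝ≥0} (hv : v ≠ 0) : Continuous (normalCDF μ v) :=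
  continuous_iff_continuousAt.2 fun x => (hasDerivAt_normalCDF μ hv x).continuousAt

theorem strictMono_normalCDF (μ : ℝ) {v : ℝ≥0} (hv : v ≠ 0) : StrictMono (normalCDF μ v) :=
  strictMono_of_deriv_pos fun x => by
    rw [(hasDerivAt_normalCDF μ hv x).deriv]
    exact normalPDF_pos μ hv x

theorem tendsto_normalCDF_atBot (μ : ℝ) (v : ℝ≥0) : Tendsto (normalCDF μ v) atBot (𝓝 0) :=
  tendsto_cdf_atBot _

theorem tendsto_normalCDF_atTop (μ : ℝ) (v : ℝ≥0) : Tendsto (normalCDF μ v) atTop (𝓝 1) :=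
  tendsto_cdf_atTop _

theorem normalCDF_pos (μ : ℝ) {v : ℝ≥0} (hv : v ≠ 0) (x : ℝ) : 0 < normalCDF μ v x :=
  (cdf_nonneg _ (x - 1)).trans_lt (strictMono_normalCDF μ hv (sub_one_lt x))

theorem normalCDF_lt_one (μ : ℝ) {v : ℝ≥0} (hv : v ≠ 0) (x : ℝ) : normalCDF μ v x < 1 :=
  (strictMono_normalCDF μ hv (lt_add_one x)).trans_le (cdf_le_one _ (x + 1))

theorem normalCDF_eq_stdCDF_sub (μ x : ℝ) : normalCDF μ 1 x = stdCDF (x - μ) := by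
  have h := gaussianReal_map_sub_const (μ := μ) (v := 1) μ
  rw [sub_self] at h
  simp only [stdCDF, normalCDF, cdf_eq_real]
  rw [← h, map_measureReal_apply (by fun_prop) measurableSet_Iic]
  congr 1
  ext y
  simp

theorem stdCDF_neg (x : ℝ) : stdCDF (-x) = 1 - stdCDF x := by
  have h := gaussianReal_map_neg (μ := 0) (v := 1)
  rw [neg_zero] at h
  have := nullSingletonClass_gaussianReal (μ := 0) (v := 1) one_ne_zero
  simp only [stdCDF, normalCDF, cdf_eq_real]
  rw [← probReal_compl_eq_one_sub measurableSet_Iic, compl_Iic,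
    measureReal_congr (Ioi_ae_eq_Ici (μ := gaussianReal 0 1) (a := x))]
  conv_lhs => rw [← h]
  rw [map_measureReal_apply (by fun_prop) measurableSet_Iic]
  congr 1
  ext y
  simp

/-! ### Smoothing the corner at s. -/

/-- A differentiable minorant of `max u 0` which is flat on the negative half-line and approaches
`max u 0` as `n → ∞`. -/
noncomputable def softRamp (n : ℕ) (u : ℝ) : ℝ := ∫ t in (0 : ℝ)..u, min 1 (n * max t 0)

theorem hasDerivAt_softRamp (n : ℕ) (u : ℝ) :
    HasDerivAt (softRamp n) (min 1 (n * max u 0)) u := by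
  have h : Continuous fun t : ℝ => min 1 (n * max t 0) := by fun_prop
  exact (h.integral_hasStrictDerivAt 0 u).hasDerivAt

theorem softRamp_of_nonpos (n : ℕ) {u : ℝ} (hu : u ≤ 0) : softRamp n u = 0 := by
  rw [softRamp, intervalIntegral.integral_congr (g := fun _ => 0)]
  · simp
  · intro t ht
    rw [uIcc_of_ge hu] at ht
    simp [max_eq_right ht.2]

theorem monotone_softRamp (n : ℕ) : Monotone (softRamp n) :=
  monotone_of_deriv_nonneg (fun u => (hasDerivAt_softRamp n u).differentiableAt) fun u => by
    rw [(hasDerivAt_softRamp n u).deriv]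
    positivity

theorem softRamp_nonneg (n : ℕ) (u : ℝ) : 0 ≤ softRamp n u := by
  rcases le_total u 0 with hu | hu
  · exact (softRamp_of_nonpos n hu).ge
  · rw [← softRamp_of_nonpos n le_rfl]
    exact monotone_softRamp n hu

theorem softRamp_le (n : ℕ) {u : ℝ} (hu : 0 ≤ u) : softRamp n u ≤ u := by
  have h : Continuous fun t : ℝ => min 1 (n * max t 0) := by fun_prop
  calc softRamp n u ≤ ∫ _ in (0 : ℝ)..u, (1 : ℝ) :=
        intervalIntegral.integral_mono_on hu (h.intervalIntegrable _ _)
          (continuous_const.intervalIntegrable _ _) fun t _ => min_le_left _ _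
    _ = u := by simp

theorem tendsto_deriv_softRamp {u : ℝ} (hu : 0 < u) :
    Tendsto (fun n : ℕ => min 1 ((n : ℝ) * max u 0)) atTop (𝓝 1) := by
  apply tendsto_const_nhds.congr'
  filter_upwards [(tendsto_natCast_atTop_atTop (R := ℝ)).eventually_ge_atTop u⁻¹] with n hn
  rw [max_eq_left hu.le, min_eq_left]
  calc (1 : ℝ) = u⁻¹ * u := by field_simp
    _ ≤ n * u := by gcongr

/-! ### The supremum of the fidelity from an optimal weight. -/

theorem admissible_deriv_eq_zero {s : ℝ} {A : ℝ → ℝ} (hA : A ∈ admissibleSet s) {x : ℝ}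
    (hx : s < x) : deriv A x = 0 := by
  obtain ⟨-, hmono, hs, hle⟩ := hA
  have h : A =ᶠ[𝓝 x] fun _ => 1 := by
    filter_upwards [lt_mem_nhds hx] with y hy
    exact le_antisymm (hle y).2 (hs ▸ hmono hy.le)
  rw [h.deriv_eq]
  simp

/-- Upper bound on the fidelity from a weighted arithmetic-geometric mean inequality. -/
theorem fidelity_le_of_weight {q ρ : ℝ → ℝ} {s F : ℝ} (hq : Continuous q) (hq0 : ∀ x, 0 ≤ q x)
    (hρ : Continuous ρ) (hρ0 : ∀ x, 0 < ρ x)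
    (hint : IntegrableOn (fun x => √(ρ x) * q x) (Iic s))
    (hF : ∫ x in Iic s, √(ρ x) * q x = F) {A : ℝ → ℝ} (hA : A ∈ admissibleSet s)
    (hub : ∀ᶠ T in atBot, ∫ x in T..s, deriv A x / √(ρ x) ≤ F) :
    fidelity (deriv A) q ≤ F := by
  have hA' := hA
  obtain ⟨hcd, hmono, hs, hle⟩ := hA
  have hdc : Continuous (deriv A) := (contDiff_one_iff_deriv.1 hcd).2
  have hd0 : ∀ x, 0 ≤ deriv A x := fun x => hmono.deriv_nonneg
  have hcont : Continuous fun x => √(deriv A x * q x) := by fun_prop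
  have hsupp : fidelity (deriv A) q = ∫ x in Iic s, √(deriv A x * q x) := by
    rw [fidelity, setIntegral_eq_integral_of_forall_compl_eq_zero]
    intro x hx
    rw [admissible_deriv_eq_zero hA' (not_le.1 hx)]
    simp
  rw [hsupp]
  by_cases hi : IntegrableOn (fun x => √(deriv A x * q x)) (Iic s)
  · have hlim := intervalIntegral_tendsto_integral_Iic s hi tendsto_id
    refine le_of_tendsto hlim ?_
    filter_upwards [hub, eventually_le_atBot s] with T hT hTs
    have hρ1 : Continuous fun x => deriv A x / √(ρ x) :=
      hdc.div (by fun_prop) fun x => (Real.sqrt_pos.2 (hρ0 x)).ne'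
    have hρ2 : Continuous fun x => √(ρ x) * q x := by fun_prop
    calc ∫ x in T..s, √(deriv A x * q x)
        ≤ ∫ x in T..s, (deriv A x / √(ρ x) + √(ρ x) * q x) / 2 := by
          refine intervalIntegral.integral_mono_on hTs (hcont.intervalIntegrable _ _)
            (Continuous.intervalIntegrable (by fun_prop) _ _) fun x _ => ?_
          have hr := Real.sqrt_pos.2 (hρ0 x)
          apply Real.sqrt_le_iff.2
          have h1 : 0 ≤ deriv A x / √(ρ x) := div_nonneg (hd0 x) hr.le
          have h2 : 0 ≤ √(ρ x) * q x := mul_nonneg hr.le (hq0 x)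
          have h3 : deriv A x * q x = (deriv A x / √(ρ x)) * (√(ρ x) * q x) := by
            field_simp
          refine ⟨by positivity, ?_⟩
          rw [h3]
          nlinarith [sq_nonneg (deriv A x / √(ρ x) - √(ρ x) * q x)]
      _ = ((∫ x in T..s, deriv A x / √(ρ x)) + ∫ x in T..s, √(ρ x) * q x) / 2 := by
          rw [intervalIntegral.integral_div, intervalIntegral.integral_add
            (hρ1.intervalIntegrable _ _) (hρ2.intervalIntegrable _ _)]
      _ ≤ (F + F) / 2 := by
          gcongr
          rw [intervalIntegral.integral_of_le hTs, ← hF]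
          exact setIntegral_mono_set hint
            (ae_of_all _ fun x => mul_nonneg (Real.sqrt_nonneg _) (hq0 x))
            Ioc_subset_Iic_self.eventuallyLE
      _ = F := by ring
  -- A non-integrable integrand has integral 0 by convention, so the bound is trivial.
  · rw [integral_undef hi, ← hF]
    exact integral_nonneg fun x => mul_nonneg (Real.sqrt_nonneg _) (hq0 x)

/-- The distribution function `1 - softRamp n (∫ x..s, ρ q)`, a smoothing of
`min 1 (1 - ∫ x..s, ρ q)`. -/
theorem smoothed_mem_admissibleSet {q ρ : ℝ → ℝ} {s : ℝ} (hq : Continuous q)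
    (hq0 : ∀ x, 0 ≤ q x) (hρ : Continuous ρ) (hρ0 : ∀ x, 0 < ρ x)
    (hU : ∀ x ≤ s, ∫ t in x..s, ρ t * q t ≤ 1 - stdCDF x) (n : ℕ) :
    (fun x => 1 - softRamp n (∫ t in x..s, ρ t * q t)) ∈ admissibleSet s ∧
    deriv (fun x => 1 - softRamp n (∫ t in x..s, ρ t * q t)) =
      fun x => min 1 (n * max (∫ t in x..s, ρ t * q t) 0) * (ρ x * q x) := by
  have hc : Continuous fun t => ρ t * q t := by fun_prop
  have hUd : ∀ x, HasDerivAt (fun x => ∫ t in x..s, ρ t * q t) (-(ρ x * q x)) x := fun x =>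
    intervalIntegral.integral_hasDerivAt_left (hc.intervalIntegrable _ _)
      hc.aestronglyMeasurable.stronglyMeasurableAtFilter hc.continuousAt
  have hd : ∀ x, HasDerivAt (fun x => 1 - softRamp n (∫ t in x..s, ρ t * q t))
      (min 1 (n * max (∫ t in x..s, ρ t * q t) 0) * (ρ x * q x)) x := fun x => by
    have := ((hasDerivAt_softRamp n _).comp x (hUd x)).const_sub 1
    rwa [mul_neg, neg_neg] at this
  have hderiv : deriv (fun x => 1 - softRamp n (∫ t in x..s, ρ t * q t)) =
      fun x => min 1 (n * max (∫ t in x..s, ρ t * q t) 0) * (ρ x * q x) :=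
    funext fun x => (hd x).deriv
  have hUc : Continuous fun x => ∫ t in x..s, ρ t * q t :=
    continuous_iff_continuousAt.2 fun x => (hUd x).continuousAt
  refine ⟨⟨contDiff_one_iff_deriv.2 ⟨fun x => (hd x).differentiableAt, ?_⟩,
    monotone_of_deriv_nonneg (fun x => (hd x).differentiableAt) fun x => ?_, ?_, fun x => ⟨?_, ?_⟩⟩,
    hderiv⟩
  · rw [hderiv]
    fun_prop
  · rw [hderiv]
    have := hρ0 x
    have := hq0 x
    positivity
  · simp [softRamp_of_nonpos]
  · rcases le_total x s with hx | hx
    · have h0 : 0 ≤ ∫ t in x..s, ρ t * q t :=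
        intervalIntegral.integral_nonneg hx fun t _ => mul_nonneg (hρ0 t).le (hq0 t)
      linarith [softRamp_le n h0, hU x hx]
    · have h0 : ∫ t in x..s, ρ t * q t ≤ 0 := by
        rw [intervalIntegral.integral_symm, neg_nonpos]
        exact intervalIntegral.integral_nonneg hx fun t _ => mul_nonneg (hρ0 t).le (hq0 t)
      simp only [softRamp_of_nonpos n h0, sub_zero]
      exact cdf_le_one _ x
  · linarith [softRamp_nonneg n (∫ t in x..s, ρ t * q t)]

/-- With U(x) = ∫ x..s, ρ q, the cutoff min 1 (n max U 0) tends to 1 where U > 0, that is left of s,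
and vanishes from s on. Dominated convergence applies with majorant √ρ q on (-∞, s]. -/
theorem tendsto_fidelity_smoothed {q ρ : ℝ → ℝ} {s : ℝ} (hq : Continuous q)
    (hq0 : ∀ x, 0 < q x) (hρ : Continuous ρ) (hρ0 : ∀ x, 0 < ρ x)
    (hint : IntegrableOn (fun x => √(ρ x) * q x) (Iic s)) :
    Tendsto (fun n : ℕ => fidelity
      (fun x => min 1 (n * max (∫ t in x..s, ρ t * q t) 0) * (ρ x * q x)) q) atTop
      (𝓝 (∫ x in Iic s, √(ρ x) * q x)) := by
  have hc : Continuous fun t => ρ t * q t := by fun_prop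
  have hUc : Continuous fun x => ∫ t in x..s, ρ t * q t := by
    simp_rw [fun x => intervalIntegral.integral_symm (μ := volume) (f := fun t => ρ t * q t) s x]
    exact (intervalIntegral.continuous_primitive (fun a b => hc.intervalIntegrable a b) s).neg
  have hpos : ∀ x < s, 0 < ∫ t in x..s, ρ t * q t := fun x hx =>
    intervalIntegral.intervalIntegral_pos_of_pos (hc.intervalIntegrable _ _)
      (fun t => mul_pos (hρ0 t) (hq0 t)) hx
  have hneg : ∀ x, s ≤ x → ∫ t in x..s, ρ t * q t ≤ 0 := fun x hx => by
    rw [intervalIntegral.integral_symm, neg_nonpos]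
    exact intervalIntegral.integral_nonneg hx fun t _ => (mul_pos (hρ0 t) (hq0 t)).le
  have hsq : ∀ m x : ℝ, √(m * (ρ x * q x) * q x) = √m * (√(ρ x) * q x) := fun m x => by
    rw [show m * (ρ x * q x) * q x = m * (ρ x * q x ^ 2) by ring,
      Real.sqrt_mul' _ (mul_nonneg (hρ0 x).le (sq_nonneg _)), Real.sqrt_mul (hρ0 x).le,
      Real.sqrt_sq (hq0 x).le]
  -- At s itself U = 0 and the cutoff is 0 for every n, so the pointwise limit lives on the open
  -- half-line.
  have heq : (∫ x in Iic s, √(ρ x) * q x) =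
      ∫ x, (Iio s).indicator (fun x => √(ρ x) * q x) x := by
    rw [integral_indicator measurableSet_Iio, integral_Iic_eq_integral_Iio]
  rw [heq]
  unfold fidelity
  simp_rw [hsq]
  refine tendsto_integral_of_dominated_convergence
    ((Iic s).indicator fun x => √(ρ x) * q x) ?_ (hint.integrable_indicator measurableSet_Iic) ?_ ?_
  · intro n
    exact Continuous.aestronglyMeasurable (by fun_prop)
  · intro n
    refine ae_of_all _ fun x => ?_
    have h0 : 0 ≤ √(ρ x) * q x := mul_nonneg (Real.sqrt_nonneg _) (hq0 x).le
    rw [Real.norm_of_nonneg (mul_nonneg (Real.sqrt_nonneg _) h0)]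
    by_cases hx : x ≤ s
    · rw [indicator_of_mem (show x ∈ Iic s from hx)]
      exact mul_le_of_le_one_left h0 (Real.sqrt_le_one.2 (min_le_left _ _))
    · rw [indicator_of_notMem (show x ∉ Iic s from hx), max_eq_right (hneg x (not_le.1 hx).le)]
      simp
  · refine ae_of_all _ fun x => ?_
    by_cases hx : x < s
    · rw [indicator_of_mem (show x ∈ Iio s from hx)]
      have h := (tendsto_deriv_softRamp (hpos x hx)).sqrt
      rw [Real.sqrt_one] at h
      simpa using h.mul_const (√(ρ x) * q x)
    · rw [indicator_of_notMem (show x ∉ Iio s from hx)]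
      simp [max_eq_right (hneg x (not_lt.1 hx))]

/-- The supremum of the squared fidelity, given a weight `ρ` for which `ρ q` is the density of an
optimal distribution function. -/
theorem sSup_fidelity_sq {q ρ : ℝ → ℝ} {s F : ℝ} (hq : Continuous q) (hq0 : ∀ x, 0 < q x)
    (hρ : Continuous ρ) (hρ0 : ∀ x, 0 < ρ x)
    (hint : IntegrableOn (fun x => √(ρ x) * q x) (Iic s))
    (hF : ∫ x in Iic s, √(ρ x) * q x = F)
    (hU : ∀ x ≤ s, ∫ t in x..s, ρ t * q t ≤ 1 - stdCDF x)
    (hub : ∀ A ∈ admissibleSet s, ∀ᶠ T in atBot, ∫ x in T..s, deriv A x / √(ρ x) ≤ F) :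
    sSup ((fun A : ℝ → ℝ => fidelity (deriv A) q ^ 2) '' admissibleSet s) = F ^ 2 := by
  have hq0' : ∀ x, 0 ≤ q x := fun x => (hq0 x).le
  have hsm := smoothed_mem_admissibleSet hq hq0' hρ hρ0 hU
  refine IsLUB.csSup_eq ⟨?_, ?_⟩ (Set.Nonempty.image _ ⟨_, (hsm 0).1⟩)
  · rintro _ ⟨A, hA, rfl⟩
    exact pow_le_pow_left₀ (integral_nonneg fun x => Real.sqrt_nonneg _)
      (fidelity_le_of_weight hq hq0' hρ hρ0 hint hF hA (hub A hA)) 2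
  · intro b hb
    have hlim := (tendsto_fidelity_smoothed hq hq0 hρ hρ0 hint).pow 2
    rw [hF] at hlim
    refine le_of_tendsto' hlim fun n => ?_
    rw [← (hsm n).2]
    exact hb ⟨_, (hsm n).1, rfl⟩

/-! ### The likelihood ratio, the overlap and the gap function. -/

/-- The likelihood ratio `N / N_{μ,v}`. -/
noncomputable def pdfRatio (μ : ℝ) (v : ℝ≥0) (x : ℝ) : ℝ :=
  √(v : ℝ) * Real.exp (-x ^ 2 / 2 + (x - μ) ^ 2 / (2 * v))

/-- `1 - Φ - (N / N_{μ,v}) (c - Φ_{μ,v})`. -/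
noncomputable def tailGap (μ : ℝ) (v : ℝ≥0) (c x : ℝ) : ℝ :=
  1 - stdCDF x - pdfRatio μ v x * (c - normalCDF μ v x)

variable {μ : ℝ} {v : ℝ≥0}

theorem pdfRatio_pos (hv : v ≠ 0) (x : ℝ) : 0 < pdfRatio μ v x :=
  mul_pos (Real.sqrt_pos.2 (NNReal.coe_pos.2 (pos_iff_ne_zero.2 hv))) (Real.exp_pos _)

theorem continuous_pdfRatio : Continuous (pdfRatio μ v) := by
  unfold pdfRatio
  fun_prop

theorem hasDerivAt_pdfRatio (hv : v ≠ 0) (x : ℝ) :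
    HasDerivAt (pdfRatio μ v) (pdfRatio μ v x * (((1 - v) * x - μ) / v)) x := by
  have hv' : (v : ℝ) ≠ 0 := by exact_mod_cast hv
  have h : HasDerivAt (fun x : ℝ => -x ^ 2 / 2 + (x - μ) ^ 2 / (2 * v))
      (((1 - v) * x - μ) / v) x := by
    have h1 := (((hasDerivAt_id' x).pow 2).neg.div_const 2).add
      ((((hasDerivAt_id' x).sub_const μ).pow 2).div_const (2 * (v : ℝ)))
    refine h1.congr_deriv ?_
    field_simp
    push_cast
    ring
  refine (h.exp.const_mul √(v : ℝ)).congr_deriv ?_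
  rw [pdfRatio]
  ring

theorem stdPDF_eq_pdfRatio_mul (hv : v ≠ 0) (x : ℝ) :
    stdPDF x = pdfRatio μ v x * normalPDF μ v x := by
  have hv' : (0 : ℝ) < v := NNReal.coe_pos.2 (pos_iff_ne_zero.2 hv)
  rw [stdPDF, normalPDF, normalPDF, pdfRatio, gaussianPDFReal, gaussianPDFReal,
    show √(v : ℝ) * Real.exp (-x ^ 2 / 2 + (x - μ) ^ 2 / (2 * v)) *
      ((√(2 * Real.pi * v))⁻¹ * Real.exp (-(x - μ) ^ 2 / (2 * v))) =
      √(v : ℝ) * (√(2 * Real.pi * v))⁻¹ * (Real.exp (-x ^ 2 / 2 + (x - μ) ^ 2 / (2 * v)) *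
      Real.exp (-(x - μ) ^ 2 / (2 * v))) by ring, ← Real.exp_add,
    Real.sqrt_mul (by positivity : 0 ≤ 2 * Real.pi) (v : ℝ)]
  have h1 := (Real.sqrt_pos.2 hv').ne'
  have h2 := (Real.sqrt_pos.2 (by positivity : 0 < 2 * Real.pi)).ne'
  congr 1
  · simp
    field_simp
  · congr 1
    simp
    ring

/-- Both sides are the geometric mean √(N N_{μ,v}); completing the square in the exponent produces
the new mean, variance and prefactor. This is where `overlap` comes from. -/
theorem sqrt_pdfRatio_mul_normalPDF (hv : v ≠ 0) (x : ℝ) :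
    √(pdfRatio μ v x) * normalPDF μ v x =
      √(2 * √(v : ℝ) / (1 + v)) * Real.exp (-(μ ^ 2 / (4 * (1 + v)))) *
        normalPDF (μ / (1 + v)) (2 * v / (1 + v)) x := by
  have hv' : (0 : ℝ) < v := NNReal.coe_pos.2 (pos_iff_ne_zero.2 hv)
  have hs := Real.sqrt_pos.2 hv'
  rw [pdfRatio, Real.sqrt_mul (Real.sqrt_nonneg _), ← Real.exp_half, normalPDF, normalPDF,
    gaussianPDFReal, gaussianPDFReal]
  push_cast
  have hc : √√(v : ℝ) * (√(2 * Real.pi * v))⁻¹ =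
      √(2 * √(v : ℝ) / (1 + v)) * (√(2 * Real.pi * (2 * v / (1 + v))))⁻¹ := by
    rw [← Real.sqrt_inv, ← Real.sqrt_inv, ← Real.sqrt_mul (by positivity),
      ← Real.sqrt_mul (by positivity)]
    congr 1
    field_simp
  have he : Real.exp ((-x ^ 2 / 2 + (x - μ) ^ 2 / (2 * v)) / 2) *
      Real.exp (-(x - μ) ^ 2 / (2 * v)) = Real.exp (-(μ ^ 2 / (4 * (1 + v)))) *
      Real.exp (-(x - μ / (1 + v)) ^ 2 / (2 * (2 * v / (1 + v)))) := by
    rw [← Real.exp_add, ← Real.exp_add]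
    congr 1
    field_simp
    ring
  linear_combination (Real.exp ((-x ^ 2 / 2 + (x - μ) ^ 2 / (2 * v)) / 2) *
    Real.exp (-(x - μ) ^ 2 / (2 * v))) * hc + (√(2 * √(v : ℝ) / (1 + v)) *
    (√(2 * Real.pi * (2 * v / (1 + v))))⁻¹) * he

theorem two_mul_div_one_add_ne_zero (hv : v ≠ 0) : 2 * v / (1 + v) ≠ 0 := by
  have := pos_iff_ne_zero.2 hv
  positivity

theorem integral_sqrt_pdfRatio (hv : v ≠ 0) (a b : ℝ) :
    ∫ x in a..b, √(pdfRatio μ v x) * normalPDF μ v x = overlap μ v b - overlap μ v a := by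
  simp_rw [sqrt_pdfRatio_mul_normalPDF hv, intervalIntegral.integral_const_mul,
    integral_normalPDF_eq_sub _ (two_mul_div_one_add_ne_zero hv), overlap]
  ring

theorem integral_Iic_sqrt_pdfRatio (hv : v ≠ 0) (b : ℝ) :
    ∫ x in Iic b, √(pdfRatio μ v x) * normalPDF μ v x = overlap μ v b := by
  simp_rw [sqrt_pdfRatio_mul_normalPDF hv, integral_const_mul,
    ← normalCDF_eq_integral _ (two_mul_div_one_add_ne_zero hv), overlap]

theorem integrable_sqrt_pdfRatio (hv : v ≠ 0) :
    Integrable fun x => √(pdfRatio μ v x) * normalPDF μ v x := by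
  simp_rw [sqrt_pdfRatio_mul_normalPDF hv]
  exact (integrable_normalPDF _ _).const_mul _

theorem overlap_nonneg (hv : v ≠ 0) (x : ℝ) : 0 ≤ overlap μ v x := by
  have := normalCDF_pos (μ / (1 + v)) (two_mul_div_one_add_ne_zero hv) x
  rw [overlap]
  positivity

theorem tendsto_overlap (μ : ℝ) (v : ℝ≥0) : Tendsto (overlap μ v) atTop
    (𝓝 (√(2 * √(v : ℝ) / (1 + v)) * Real.exp (-(μ ^ 2 / (4 * (1 + v)))))) := by
  have h := (tendsto_normalCDF_atTop (μ / (1 + v)) (2 * v / (1 + v))).const_mul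
    (√(2 * √(v : ℝ) / (1 + v)) * Real.exp (-(μ ^ 2 / (4 * (1 + v)))))
  rwa [mul_one] at h

theorem hasDerivAt_stdCDF (x : ℝ) : HasDerivAt stdCDF (stdPDF x) x :=
  hasDerivAt_normalCDF 0 one_ne_zero x

theorem stdCDF_pos (x : ℝ) : 0 < stdCDF x := normalCDF_pos 0 one_ne_zero x

theorem stdCDF_lt_one (x : ℝ) : stdCDF x < 1 := normalCDF_lt_one 0 one_ne_zero x

/-- Because N = r N_{μ,v}, the terms from differentiating the two distribution functions cancel;
only the one with r' survives, so the sign is explicit. -/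
theorem hasDerivAt_tailGap (hv : v ≠ 0) (c x : ℝ) :
    HasDerivAt (tailGap μ v c)
      (-(pdfRatio μ v x * (((1 - v) * x - μ) / v)) * (c - normalCDF μ v x)) x := by
  refine (((hasDerivAt_stdCDF x).const_sub 1).sub ((hasDerivAt_pdfRatio (μ := μ) hv x).mul
    ((hasDerivAt_normalCDF μ hv x).const_sub c))).congr_deriv ?_
  rw [stdPDF_eq_pdfRatio_mul (μ := μ) hv]
  ring

theorem continuous_tailGap (hv : v ≠ 0) (c : ℝ) : Continuous (tailGap μ v c) :=
  continuous_iff_continuousAt.2 fun x => (hasDerivAt_tailGap hv c x).continuousAt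

theorem stdPDF_div_normalPDF (hv : v ≠ 0) (x : ℝ) :
    stdPDF x / normalPDF μ v x = pdfRatio μ v x := by
  rw [stdPDF_eq_pdfRatio_mul (μ := μ) hv, mul_div_cancel_right₀ _ (normalPDF_pos μ hv x).ne']

/-- For x ≥ s the quotient is nonpositive (0 by convention at x = s) while r > 0, so roots lie left
of s, where the denominator can be cleared. -/
theorem betaEquation_iff (hv : v ≠ 0) (s x : ℝ) :
    BetaEquation μ v s x ↔ x < s ∧ tailGap μ v (normalCDF μ v s) x = 0 := by
  rw [BetaEquation, stdPDF_div_normalPDF hv, tailGap]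
  have hr := pdfRatio_pos (μ := μ) hv x
  have hP := stdCDF_lt_one x
  rcases lt_or_ge x s with h | h
  · have hQ := strictMono_normalCDF μ hv h
    rw [div_eq_iff (sub_pos.2 hQ).ne', sub_eq_zero]
    exact (and_iff_right h).symm
  · have hQ := (strictMono_normalCDF μ hv).monotone h
    refine iff_of_false (fun he => ?_) fun he => (not_lt.2 h) he.1
    have : (1 - stdCDF x) / (normalCDF μ v s - normalCDF μ v x) ≤ 0 :=
      div_nonpos_of_nonneg_of_nonpos (by linarith) (by linarith)
    linarith

theorem alphaEquation_iff (hv : v ≠ 0) (x : ℝ) :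
    AlphaEquation μ v x ↔ tailGap μ v 0 x = 1 := by
  rw [AlphaEquation, stdPDF_div_normalPDF hv, tailGap, div_eq_iff (normalCDF_pos μ hv x).ne']
  constructor <;> intro h <;> linarith

/-! ### Bounds for monotone weights and comparison of quotients. -/

/-- Integration by parts against a monotone weight, for an admissible function dominating `Φ`. -/
theorem integral_deriv_mul_le {s a b : ℝ} {A k k' : ℝ → ℝ} (hA : A ∈ admissibleSet s) (hab : a ≤ b)
    (hk : ∀ x, HasDerivAt k (k' x) x) (hk' : Continuous k') (hk0 : ∀ x ∈ Icc a b, 0 ≤ k' x) :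
    ∫ x in a..b, deriv A x * k x ≤
      (∫ x in a..b, stdPDF x * k x) + (A b - stdCDF b) * k b - (A a - stdCDF a) * k a := by
  obtain ⟨hcd, -, -, hle⟩ := hA
  obtain ⟨hd, hdc⟩ := contDiff_one_iff_deriv.1 hcd
  have hpc : Continuous stdPDF := continuous_normalPDF 0 1
  have hkc : Continuous k := continuous_iff_continuousAt.2 fun x => (hk x).continuousAt
  have h := intervalIntegral.integral_deriv_mul_eq_sub (a := a) (b := b)
    (u := fun x => A x - stdCDF x) (u' := fun x => deriv A x - stdPDF x) (v := k) (v' := k')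
    (fun x _ => (hd x).hasDerivAt.sub (hasDerivAt_stdCDF x)) (fun x _ => hk x)
    (Continuous.intervalIntegrable (by fun_prop) _ _) (hk'.intervalIntegrable _ _)
  have hAc : Continuous A := hd.continuous
  have hPc : Continuous stdCDF := continuous_normalCDF 0 one_ne_zero
  have hsplit : ∫ x in a..b, (deriv A x - stdPDF x) * k x + (A x - stdCDF x) * k' x =
      (∫ x in a..b, deriv A x * k x) - (∫ x in a..b, stdPDF x * k x) +
        ∫ x in a..b, (A x - stdCDF x) * k' x := by
    rw [← intervalIntegral.integral_sub, ← intervalIntegral.integral_add]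
    · congr 1
      ext x
      ring
    all_goals exact Continuous.intervalIntegrable (by fun_prop) _ _
  have hnn : 0 ≤ ∫ x in a..b, (A x - stdCDF x) * k' x :=
    intervalIntegral.integral_nonneg hab fun x hx =>
      mul_nonneg (sub_nonneg.2 (hle x).1) (hk0 x hx)
  rw [hsplit] at h
  linarith

theorem hasDerivAt_inv_sqrt_pdfRatio (hv : v ≠ 0) (x : ℝ) :
    HasDerivAt (fun x => (√(pdfRatio μ v x))⁻¹)
      (-(((1 - v) * x - μ) / v) / (2 * √(pdfRatio μ v x))) x := by
  have hr := pdfRatio_pos (μ := μ) hv x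
  refine (((hasDerivAt_pdfRatio (μ := μ) hv x).sqrt hr.ne').inv
    (Real.sqrt_pos.2 hr).ne').congr_deriv ?_
  rw [Real.sq_sqrt hr.le]
  field_simp

/-- On an interval where `N / N_{μ,v}` is antitone, the weighted mass of an admissible function is
controlled by the overlap. -/
theorem integral_deriv_div_sqrt_pdfRatio_le (hv : v ≠ 0) {s a b : ℝ} {A : ℝ → ℝ}
    (hA : A ∈ admissibleSet s) (hab : a ≤ b) (hdec : ∀ x ∈ Icc a b, (1 - v) * x - μ ≤ 0) :
    ∫ x in a..b, deriv A x / √(pdfRatio μ v x) ≤ overlap μ v b - overlap μ v a +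
      (A b - stdCDF b) / √(pdfRatio μ v b) - (A a - stdCDF a) / √(pdfRatio μ v a) := by
  have hr := fun x => Real.sqrt_pos.2 (pdfRatio_pos (μ := μ) hv x)
  have hc := continuous_pdfRatio (μ := μ) (v := v)
  simp only [div_eq_mul_inv _ √_]
  refine (integral_deriv_mul_le hA hab (hasDerivAt_inv_sqrt_pdfRatio (μ := μ) hv) ?_ ?_).trans_eq ?_
  · exact Continuous.div (by fun_prop) (by fun_prop) fun x => (mul_pos two_pos (hr x)).ne'
  · intro x hx
    have h1 : ((1 - v) * x - μ) / v ≤ 0 := div_nonpos_of_nonpos_of_nonneg (hdec x hx) v.2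
    exact div_nonneg (neg_nonneg.2 h1) (mul_nonneg two_pos.le (hr x).le)
  -- N/√r = √r N_{μ,v}, so the Gaussian term integrates to the overlap.
  · rw [← integral_sqrt_pdfRatio hv]
    congr 3
    ext x
    rw [stdPDF_eq_pdfRatio_mul (μ := μ) hv]
    nth_rewrite 1 [← Real.mul_self_sqrt (pdfRatio_pos (μ := μ) hv x).le]
    have := (hr x).ne'
    field_simp

/-- The quotient (1 - Φ)/(Φ_{μ,v}(s) - Φ_{μ,v}) has a derivative with the sign of the gap, so it is
nondecreasing on [β, s), starting from r(β). This is the feasibility of the affine piece to the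
right of β. -/
theorem pdfRatio_mul_sub_le (hv : v ≠ 0) {s β x : ℝ}
    (hβ : tailGap μ v (normalCDF μ v s) β = 0)
    (hG : ∀ y, β < y → y < s → 0 ≤ tailGap μ v (normalCDF μ v s) y) (hx : β ≤ x) (hxs : x ≤ s) :
    pdfRatio μ v β * (normalCDF μ v s - normalCDF μ v x) ≤ 1 - stdCDF x := by
  rcases hxs.eq_or_lt with rfl | hxs
  · rw [sub_self, mul_zero]
    exact sub_nonneg.2 (stdCDF_lt_one x).le
  have hQ : ∀ y ∈ Ico β s, 0 < normalCDF μ v s - normalCDF μ v y := fun y hy =>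
    sub_pos.2 (strictMono_normalCDF μ hv hy.2)
  have hd : ∀ y ∈ Ico β s, HasDerivAt
      (fun y => (1 - stdCDF y) / (normalCDF μ v s - normalCDF μ v y))
      ((-stdPDF y * (normalCDF μ v s - normalCDF μ v y) - (1 - stdCDF y) * -normalPDF μ v y) /
        (normalCDF μ v s - normalCDF μ v y) ^ 2) y := fun y hy =>
    ((hasDerivAt_stdCDF y).const_sub 1).div ((hasDerivAt_normalCDF μ hv y).const_sub _)
      (hQ y hy).ne'
  have hmono : MonotoneOn (fun y => (1 - stdCDF y) / (normalCDF μ v s - normalCDF μ v y))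
      (Ico β s) := by
    refine monotoneOn_of_deriv_nonneg (convex_Ico β s)
      (fun y hy => (hd y hy).continuousAt.continuousWithinAt)
      (fun y hy => (hd y (interior_subset hy)).differentiableAt.differentiableWithinAt)
      fun y hy => ?_
    rw [(hd y (interior_subset hy)).deriv]
    rw [interior_Ico] at hy
    refine div_nonneg ?_ (sq_nonneg _)
    have h := mul_nonneg (normalPDF_pos μ hv y).le (hG y hy.1 hy.2)
    rw [stdPDF_eq_pdfRatio_mul (μ := μ) hv]
    rw [tailGap] at h
    linarith
  have hβs : β ∈ Ico β s := ⟨le_rfl, hx.trans_lt hxs⟩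
  have h := hmono hβs ⟨hx, hxs⟩ hx
  have hr : (1 - stdCDF β) / (normalCDF μ v s - normalCDF μ v β) = pdfRatio μ v β := by
    rw [div_eq_iff (hQ β hβs).ne']
    exact sub_eq_zero.1 hβ
  simp only [hr] at h
  exact (le_div_iff₀ (hQ x ⟨hx, hxs⟩)).1 h

/-- Critical points of Φ/Φ_{μ,v} are thus the roots of the equation for α. The maximum of this
quotient decides whether a multiple of Φ_{μ,v} stays above Φ. -/
theorem hasDerivAt_stdCDF_div (hv : v ≠ 0) (x : ℝ) :
    HasDerivAt (fun y => stdCDF y / normalCDF μ v y)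
      (normalPDF μ v x * (tailGap μ v 0 x - 1) / normalCDF μ v x ^ 2) x := by
  refine ((hasDerivAt_stdCDF x).div (hasDerivAt_normalCDF μ hv x)
    (normalCDF_pos μ hv x).ne').congr_deriv ?_
  rw [stdPDF_eq_pdfRatio_mul (μ := μ) hv, tailGap]
  ring

theorem stdCDF_div_le_of_le (hv : v ≠ 0) {α x : ℝ} (h : ∀ y < α, 1 ≤ tailGap μ v 0 y)
    (hx : x ≤ α) : stdCDF x / normalCDF μ v x ≤ stdCDF α / normalCDF μ v α := by
  refine monotoneOn_of_deriv_nonneg (convex_Iic α)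
    (fun y _ => (hasDerivAt_stdCDF_div (μ := μ) hv y).continuousAt.continuousWithinAt)
    (fun y _ => (hasDerivAt_stdCDF_div hv y).differentiableAt.differentiableWithinAt)
    (fun y hy => ?_) hx self_mem_Iic hx
  rw [(hasDerivAt_stdCDF_div hv y).deriv]
  rw [interior_Iic] at hy
  exact div_nonneg (mul_nonneg (normalPDF_pos μ hv y).le (sub_nonneg.2 (h y hy))) (sq_nonneg _)

theorem stdCDF_div_le_of_ge (hv : v ≠ 0) {α x : ℝ} (h : ∀ y, α < y → tailGap μ v 0 y ≤ 1)
    (hx : α ≤ x) : stdCDF x / normalCDF μ v x ≤ stdCDF α / normalCDF μ v α := by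
  refine antitoneOn_of_deriv_nonpos (convex_Ici α)
    (fun y _ => (hasDerivAt_stdCDF_div (μ := μ) hv y).continuousAt.continuousWithinAt)
    (fun y _ => (hasDerivAt_stdCDF_div hv y).differentiableAt.differentiableWithinAt)
    (fun y hy => ?_) self_mem_Ici hx hx
  rw [(hasDerivAt_stdCDF_div hv y).deriv]
  rw [interior_Ici] at hy
  exact div_nonpos_of_nonpos_of_nonneg
    (mul_nonpos_of_nonneg_of_nonpos (normalPDF_pos μ hv y).le (sub_nonpos.2 (h y hy)))
    (sq_nonneg _)

/-! ### The value of Z for each shape of the optimal distribution function. -/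

theorem integral_deriv_admissible {s : ℝ} {A : ℝ → ℝ} (hA : A ∈ admissibleSet s) (a b : ℝ) :
    ∫ x in a..b, deriv A x = A b - A a := by
  obtain ⟨hd, hdc⟩ := contDiff_one_iff_deriv.1 hA.1
  exact intervalIntegral.integral_deriv_eq_sub (fun x _ => hd x) (hdc.intervalIntegrable _ _)

theorem integral_stdPDF (a b : ℝ) : ∫ x in a..b, stdPDF x = stdCDF b - stdCDF a :=
  integral_normalPDF_eq_sub 0 one_ne_zero a b

/-- If `Φ_{μ,v} / Φ_{μ,v}(s)` dominates `Φ` below `s`, it is optimal. -/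
theorem rayleighNormal_eq_of_dominated (hv : v ≠ 0) {s : ℝ}
    (h : ∀ x ≤ s, stdCDF x * normalCDF μ v s ≤ normalCDF μ v x) :
    rayleighNormal v s μ = 1 - normalCDF μ v s := by
  have hQ := normalCDF_pos μ hv s
  have hq := continuous_normalPDF μ v
  have hc : 0 < √(normalCDF μ v s)⁻¹ := Real.sqrt_pos.2 (inv_pos.2 hQ)
  have hsq : √(normalCDF μ v s)⁻¹ * √(normalCDF μ v s)⁻¹ = (normalCDF μ v s)⁻¹ :=
    Real.mul_self_sqrt (inv_pos.2 hQ).le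
  -- This constant weight gives the density of Φ_{μ,v} / Φ_{μ,v}(s).
  rw [rayleighNormal, sSup_fidelity_sq (ρ := fun _ => (normalCDF μ v s)⁻¹)
    (F := √(normalCDF μ v s)⁻¹ * normalCDF μ v s) hq (normalPDF_pos μ hv) continuous_const
    (fun _ => inv_pos.2 hQ) ((integrable_normalPDF μ v).const_mul _).integrableOn]
  · rw [pow_two, show √(normalCDF μ v s)⁻¹ * normalCDF μ v s *
      (√(normalCDF μ v s)⁻¹ * normalCDF μ v s) = √(normalCDF μ v s)⁻¹ * √(normalCDF μ v s)⁻¹ *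
      (normalCDF μ v s * normalCDF μ v s) by ring, hsq]
    field_simp
  · rw [integral_const_mul, normalCDF_eq_integral μ hv]
  · intro x hx
    rw [intervalIntegral.integral_const_mul, integral_normalPDF_eq_sub μ hv, inv_mul_le_iff₀ hQ]
    linarith [h x hx]
  · intro A hA
    refine Eventually.of_forall fun T => ?_
    rw [intervalIntegral.integral_div, integral_deriv_admissible hA, hA.2.2.1, div_le_iff₀ hc]
    have h1 : √(normalCDF μ v s)⁻¹ * normalCDF μ v s * √(normalCDF μ v s)⁻¹ = 1 := by
      rw [mul_right_comm, hsq, inv_mul_cancel₀ hQ.ne']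
    rw [h1]
    linarith [(hA.2.2.2 T).1, stdCDF_pos T]

/-- The equation for β reads 1 - Φ(β) = r(β) (Φ_{μ,v}(s) - Φ_{μ,v}(β)), which identifies the product
of roots with ∫ √ρ N_{μ,v} over [β, s] for ρ = r(β). -/
theorem sqrt_tail_mul_sqrt_tail (hv : v ≠ 0) {s β : ℝ} (hβs : β < s)
    (hβ : tailGap μ v (normalCDF μ v s) β = 0) :
    √(1 - stdCDF β) * √(normalCDF μ v s - normalCDF μ v β) =
      √(pdfRatio μ v β) * (normalCDF μ v s - normalCDF μ v β) := by
  have hQ := sub_pos.2 (strictMono_normalCDF μ hv hβs)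
  rw [sub_eq_zero.1 hβ, Real.sqrt_mul (pdfRatio_pos hv β).le, mul_assoc, Real.mul_self_sqrt hQ.le]

theorem tail_div_sqrt_pdfRatio (hv : v ≠ 0) {s β : ℝ}
    (hβ : tailGap μ v (normalCDF μ v s) β = 0) :
    (1 - stdCDF β) / √(pdfRatio μ v β) =
      √(pdfRatio μ v β) * (normalCDF μ v s - normalCDF μ v β) := by
  have hr := pdfRatio_pos (μ := μ) hv β
  rw [sub_eq_zero.1 hβ, div_eq_iff (Real.sqrt_pos.2 hr).ne', mul_right_comm,
    Real.mul_self_sqrt hr.le]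

theorem setIntegral_Iic_eq_add {f : ℝ → ℝ} {a b : ℝ} (h : IntegrableOn f (Iic b)) (hab : a ≤ b) :
    ∫ x in Iic b, f x = (∫ x in Iic a, f x) + ∫ x in a..b, f x := by
  rw [← intervalIntegral.integral_Iic_sub_Iic (h.mono_set (Iic_subset_Iic.2 hab)) h]
  ring

theorem integral_congr_Icc {f g : ℝ → ℝ} {a b : ℝ} (hab : a ≤ b) (h : ∀ x ∈ Icc a b, f x = g x) :
    ∫ x in a..b, f x = ∫ x in a..b, g x :=
  intervalIntegral.integral_congr fun x hx => h x (uIcc_of_le hab ▸ hx)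

section weight

variable {ρ : ℝ → ℝ} {s a b c : ℝ}

theorem integral_weight_mul_of_const (hv : v ≠ 0) (hab : a ≤ b) (h : ∀ x ∈ Icc a b, ρ x = c) :
    ∫ x in a..b, ρ x * normalPDF μ v x = c * (normalCDF μ v b - normalCDF μ v a) := by
  rw [integral_congr_Icc (g := fun x => c * normalPDF μ v x) hab fun x hx => by rw [h x hx],
    intervalIntegral.integral_const_mul, integral_normalPDF_eq_sub μ hv]

theorem integral_weight_mul_of_ratio (hv : v ≠ 0) (hab : a ≤ b)
    (h : ∀ x ∈ Icc a b, ρ x = pdfRatio μ v x) :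
    ∫ x in a..b, ρ x * normalPDF μ v x = stdCDF b - stdCDF a := by
  rw [integral_congr_Icc (g := stdPDF) hab fun x hx => by
    rw [h x hx, ← stdPDF_eq_pdfRatio_mul hv], integral_stdPDF]

theorem integral_sqrt_weight_of_const (hv : v ≠ 0) (hab : a ≤ b) (h : ∀ x ∈ Icc a b, ρ x = c) :
    ∫ x in a..b, √(ρ x) * normalPDF μ v x = √c * (normalCDF μ v b - normalCDF μ v a) :=
  integral_weight_mul_of_const hv hab fun x hx => by rw [h x hx]

theorem integral_sqrt_weight_of_ratio (hv : v ≠ 0) (hab : a ≤ b)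
    (h : ∀ x ∈ Icc a b, ρ x = pdfRatio μ v x) :
    ∫ x in a..b, √(ρ x) * normalPDF μ v x = overlap μ v b - overlap μ v a := by
  rw [← integral_sqrt_pdfRatio hv]
  exact integral_congr_Icc hab fun x hx => by rw [h x hx]

theorem integral_deriv_div_weight_of_const {A : ℝ → ℝ} (hA : A ∈ admissibleSet s) (hab : a ≤ b)
    (h : ∀ x ∈ Icc a b, ρ x = c) :
    ∫ x in a..b, deriv A x / √(ρ x) = (A b - A a) / √c := by
  rw [integral_congr_Icc (g := fun x => deriv A x / √c) hab fun x hx => by rw [h x hx],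
    intervalIntegral.integral_div, integral_deriv_admissible hA]

theorem integral_deriv_div_weight_of_ratio (hv : v ≠ 0) {A : ℝ → ℝ} (hA : A ∈ admissibleSet s)
    (hab : a ≤ b) (h : ∀ x ∈ Icc a b, ρ x = pdfRatio μ v x)
    (hdec : ∀ x ∈ Icc a b, (1 - v) * x - μ ≤ 0) :
    ∫ x in a..b, deriv A x / √(ρ x) ≤ overlap μ v b - overlap μ v a +
      (A b - stdCDF b) / √(pdfRatio μ v b) - (A a - stdCDF a) / √(pdfRatio μ v a) := by
  rw [integral_congr_Icc (g := fun x => deriv A x / √(pdfRatio μ v x)) hab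
    fun x hx => by rw [h x hx]]
  exact integral_deriv_div_sqrt_pdfRatio_le hv hA hab hdec

theorem intervalIntegrable_deriv_div_weight {A : ℝ → ℝ} (hA : A ∈ admissibleSet s)
    (hρ : Continuous ρ) (hρ0 : ∀ x, 0 < ρ x) (a b : ℝ) :
    IntervalIntegrable (fun x => deriv A x / √(ρ x)) volume a b :=
  ((contDiff_one_iff_deriv.1 hA.1).2.div (by fun_prop)
    fun x => (Real.sqrt_pos.2 (hρ0 x)).ne').intervalIntegrable _ _

end weight

/-- The optimal distribution function is `Φ` up to `β` and affine in `Φ_{μ,v}` on `[β, s]`. -/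
theorem rayleighNormal_eq_of_beta (hv : v ≠ 0) {s β : ℝ} (hβs : β < s)
    (hβ : tailGap μ v (normalCDF μ v s) β = 0)
    (hG : ∀ y, β < y → y < s → 0 ≤ tailGap μ v (normalCDF μ v s) y)
    (hdec : ∀ x ≤ β, (1 - v) * x - μ ≤ 0) :
    rayleighNormal v s μ =
      1 - (√(1 - stdCDF β) * √(normalCDF μ v s - normalCDF μ v β) + overlap μ v β) ^ 2 := by
  have hq := continuous_normalPDF μ v
  have hr := continuous_pdfRatio (μ := μ) (v := v)
  -- Freezing r at its value at β keeps ρ continuous.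
  set ρ : ℝ → ℝ := fun x => pdfRatio μ v (min x β) with hρ
  have hρc : Continuous ρ := by fun_prop
  have hρ0 : ∀ x, 0 < ρ x := fun _ => pdfRatio_pos hv _
  have hlow : ∀ x ≤ β, ρ x = pdfRatio μ v x := fun x hx => by simp only [hρ, min_eq_left hx]
  have hhigh : ∀ x, β ≤ x → ρ x = pdfRatio μ v β := fun x hx => by simp only [hρ, min_eq_right hx]
  have hint : IntegrableOn (fun x => √(ρ x) * normalPDF μ v x) (Iic s) := by
    rw [← Iic_union_Ioc_eq_Iic hβs.le]
    refine IntegrableOn.union ((integrable_sqrt_pdfRatio (μ := μ) hv).integrableOn.congr_fun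
      (fun x hx => by simp only [hlow x hx]) measurableSet_Iic) ?_
    exact (Continuous.integrableOn_Icc (by fun_prop)).mono_set Ioc_subset_Icc_self
  rw [rayleighNormal, sqrt_tail_mul_sqrt_tail hv hβs hβ,
    sSup_fidelity_sq hq (normalPDF_pos μ hv) hρc hρ0 hint]
  · rw [setIntegral_Iic_eq_add hint hβs.le,
      integral_sqrt_weight_of_const hv hβs.le fun x hx => hhigh x hx.1, add_comm]
    congr 1
    rw [← integral_Iic_sqrt_pdfRatio hv]
    exact setIntegral_congr_fun measurableSet_Iic fun x hx => by simp only [hlow x hx]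
  · intro x hx
    rcases le_total β x with hx' | hx'
    · rw [integral_weight_mul_of_const hv hx fun t ht => hhigh t (hx'.trans ht.1)]
      exact pdfRatio_mul_sub_le hv hβ hG hx' hx
    · have hc : Continuous fun t => ρ t * normalPDF μ v t := by fun_prop
      rw [← intervalIntegral.integral_add_adjacent_intervals (hc.intervalIntegrable x β)
        (hc.intervalIntegrable β s), integral_weight_mul_of_ratio hv hx' fun t ht => hlow t ht.2,
        integral_weight_mul_of_const hv hβs.le fun t ht => hhigh t ht.1, ← sub_eq_zero.1 hβ]
      linarith
  · intro A hA
    filter_upwards [eventually_le_atBot β] with T hT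
    have hi := intervalIntegrable_deriv_div_weight hA hρc hρ0
    rw [← intervalIntegral.integral_add_adjacent_intervals (hi T β) (hi β s),
      integral_deriv_div_weight_of_const hA hβs.le fun t ht => hhigh t ht.1,
      ← tail_div_sqrt_pdfRatio hv hβ, hA.2.2.1]
    have h1 := integral_deriv_div_weight_of_ratio hv hA hT (fun t ht => hlow t ht.2)
      fun t ht => hdec t ht.2
    have h2 : 0 ≤ (A T - stdCDF T) / √(pdfRatio μ v T) :=
      div_nonneg (sub_nonneg.2 (hA.2.2.2 T).1) (Real.sqrt_nonneg _)
    have h3 := overlap_nonneg (μ := μ) hv T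
    -- A(β) cancels between the two pieces because ρ is continuous at β; the terms at T have a
    -- favourable sign.
    have h4 : (1 - stdCDF β) / √(pdfRatio μ v β) = (A β - stdCDF β) / √(pdfRatio μ v β) +
      (1 - A β) / √(pdfRatio μ v β) := by ring
    linarith

/-- The optimal distribution function is proportional to `Φ_{μ,v}` up to `α`, equal to `Φ` on
`[α, β]` and affine in `Φ_{μ,v}` on `[β, s]`. -/
theorem rayleighNormal_eq_of_alpha_beta (hv : v ≠ 0) {s α β : ℝ} (hαβ : α < β) (hβs : β < s)
    (hα : tailGap μ v 0 α = 1) (hα' : ∀ y < α, 1 ≤ tailGap μ v 0 y)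
    (hβ : tailGap μ v (normalCDF μ v s) β = 0)
    (hG : ∀ y, β < y → y < s → 0 ≤ tailGap μ v (normalCDF μ v s) y)
    (hdec : ∀ x ∈ Icc α β, (1 - v) * x - μ ≤ 0) :
    rayleighNormal v s μ =
      1 - (√(stdCDF α * normalCDF μ v α) + overlap μ v β - overlap μ v α
        + √(1 - stdCDF β) * √(normalCDF μ v s - normalCDF μ v β)) ^ 2 := by
  have hq := continuous_normalPDF μ v
  have hr := continuous_pdfRatio (μ := μ) (v := v)
  have hrα := pdfRatio_pos (μ := μ) hv α
  have hQα := normalCDF_pos μ hv α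
  have hPα : stdCDF α = pdfRatio μ v α * normalCDF μ v α := by
    rw [tailGap] at hα
    linarith
  have hsq : √(stdCDF α * normalCDF μ v α) = √(pdfRatio μ v α) * normalCDF μ v α := by
    rw [hPα, mul_assoc, Real.sqrt_mul hrα.le, Real.sqrt_mul_self hQα.le]
  -- r is frozen outside [α, β].
  set ρ : ℝ → ℝ := fun x => pdfRatio μ v (max α (min x β)) with hρ
  have hρc : Continuous ρ := by fun_prop
  have hρ0 : ∀ x, 0 < ρ x := fun _ => pdfRatio_pos hv _
  have hlow : ∀ x ≤ α, ρ x = pdfRatio μ v α := fun x hx => by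
    simp only [hρ, min_eq_left (hx.trans hαβ.le), max_eq_left hx]
  have hmid : ∀ x ∈ Icc α β, ρ x = pdfRatio μ v x := fun x hx => by
    simp only [hρ, min_eq_left hx.2, max_eq_right hx.1]
  have hhigh : ∀ x, β ≤ x → ρ x = pdfRatio μ v β := fun x hx => by
    simp only [hρ, min_eq_right hx, max_eq_right hαβ.le]
  have hint : IntegrableOn (fun x => √(ρ x) * normalPDF μ v x) (Iic s) := by
    rw [← Iic_union_Ioc_eq_Iic (hαβ.trans hβs).le]
    refine IntegrableOn.union
      (((integrable_normalPDF μ v).const_mul √(pdfRatio μ v α)).integrableOn.congr_fun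
      (fun x hx => by simp only [hlow x hx]) measurableSet_Iic) ?_
    exact (Continuous.integrableOn_Icc (by fun_prop)).mono_set Ioc_subset_Icc_self
  rw [rayleighNormal, sqrt_tail_mul_sqrt_tail hv hβs hβ, hsq,
    sSup_fidelity_sq hq (normalPDF_pos μ hv) hρc hρ0 hint]
  · have h1 : ∫ x in Iic α, √(ρ x) * normalPDF μ v x = √(pdfRatio μ v α) * normalCDF μ v α := by
      rw [normalCDF_eq_integral μ hv, ← integral_const_mul]
      exact setIntegral_congr_fun measurableSet_Iic fun x hx => by simp only [hlow x hx]
    rw [setIntegral_Iic_eq_add hint hβs.le,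
      setIntegral_Iic_eq_add (hint.mono_set (Iic_subset_Iic.2 hβs.le)) hαβ.le, h1,
      integral_sqrt_weight_of_ratio hv hαβ.le hmid,
      integral_sqrt_weight_of_const hv hβs.le fun x hx => hhigh x hx.1]
    ring
  · have hc : Continuous fun t => ρ t * normalPDF μ v t := by fun_prop
    have hUβ : ∫ t in β..s, ρ t * normalPDF μ v t = 1 - stdCDF β := by
      rw [integral_weight_mul_of_const hv hβs.le fun t ht => hhigh t ht.1]
      exact (sub_eq_zero.1 hβ).symm
    intro x hx
    rcases le_total β x with hx' | hx'
    · rw [integral_weight_mul_of_const hv hx fun t ht => hhigh t (hx'.trans ht.1)]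
      exact pdfRatio_mul_sub_le hv hβ hG hx' hx
    rw [← intervalIntegral.integral_add_adjacent_intervals (hc.intervalIntegrable x β)
        (hc.intervalIntegrable β s), hUβ]
    rcases le_total α x with hxα | hxα
    · rw [integral_weight_mul_of_ratio hv hx' fun t ht => hmid t ⟨hxα.trans ht.1, ht.2⟩]
      linarith
    · rw [← intervalIntegral.integral_add_adjacent_intervals (hc.intervalIntegrable x α)
        (hc.intervalIntegrable α β), integral_weight_mul_of_ratio hv hαβ.le hmid,
        integral_weight_mul_of_const hv hxα fun t ht => hlow t ht.2]
      -- Feasibility left of α: there Φ/Φ_{μ,v} is at most its value r(α) at α.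
      have h1 := stdCDF_div_le_of_le hv hα' hxα
      rw [hPα, mul_div_cancel_right₀ _ hQα.ne', div_le_iff₀ (normalCDF_pos μ hv x)] at h1
      linarith
  · intro A hA
    filter_upwards [eventually_le_atBot α] with T hT
    have hi := intervalIntegrable_deriv_div_weight hA hρc hρ0
    rw [← intervalIntegral.integral_add_adjacent_intervals (hi T β) (hi β s),
      ← intervalIntegral.integral_add_adjacent_intervals (hi T α) (hi α β),
      integral_deriv_div_weight_of_const hA hT fun t ht => hlow t ht.2,
      integral_deriv_div_weight_of_const hA hβs.le fun t ht => hhigh t ht.1,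
      ← tail_div_sqrt_pdfRatio hv hβ, hA.2.2.1]
    have h1 := integral_deriv_div_weight_of_ratio hv hA hαβ.le hmid hdec
    have h2 : 0 ≤ A T / √(pdfRatio μ v α) :=
      div_nonneg ((stdCDF_pos T).le.trans (hA.2.2.2 T).1) (Real.sqrt_nonneg _)
    have h3 : stdCDF α / √(pdfRatio μ v α) = √(pdfRatio μ v α) * normalCDF μ v α := by
      rw [hPα, div_eq_iff (Real.sqrt_pos.2 hrα).ne', mul_right_comm, Real.mul_self_sqrt hrα.le]
    rw [← h3]
    simp only [sub_div] at h1 ⊢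
    linarith

/-! ### Monotonicity and limits of the gap function. -/

theorem strictMonoOn_tailGap (hv : v ≠ 0) {c : ℝ} {D : Set ℝ} (hD : Convex ℝ D)
    (h : ∀ x ∈ interior D, ((1 - v) * x - μ) * (c - normalCDF μ v x) < 0) :
    StrictMonoOn (tailGap μ v c) D := by
  have hv' : (0 : ℝ) < v := NNReal.coe_pos.2 (pos_iff_ne_zero.2 hv)
  refine strictMonoOn_of_deriv_pos hD (continuous_tailGap hv c).continuousOn fun x hx => ?_
  rw [(hasDerivAt_tailGap hv c x).deriv, show -(pdfRatio μ v x * (((1 - v) * x - μ) / v)) *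
    (c - normalCDF μ v x) = pdfRatio μ v x / v * -(((1 - v) * x - μ) * (c - normalCDF μ v x)) by
      ring]
  exact mul_pos (div_pos (pdfRatio_pos hv x) hv') (neg_pos.2 (h x hx))

theorem strictAntiOn_tailGap (hv : v ≠ 0) {c : ℝ} {D : Set ℝ} (hD : Convex ℝ D)
    (h : ∀ x ∈ interior D, 0 < ((1 - v) * x - μ) * (c - normalCDF μ v x)) :
    StrictAntiOn (tailGap μ v c) D := by
  have hv' : (0 : ℝ) < v := NNReal.coe_pos.2 (pos_iff_ne_zero.2 hv)
  refine strictAntiOn_of_deriv_neg hD (continuous_tailGap hv c).continuousOn fun x hx => ?_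
  rw [(hasDerivAt_tailGap hv c x).deriv, show -(pdfRatio μ v x * (((1 - v) * x - μ) / v)) *
    (c - normalCDF μ v x) = -(pdfRatio μ v x / v * (((1 - v) * x - μ) * (c - normalCDF μ v x))) by
      ring]
  exact neg_neg_of_pos (mul_pos (div_pos (pdfRatio_pos hv x) hv') (h x hx))

theorem pdfRatio_eq (hv : v ≠ 0) (x : ℝ) : pdfRatio μ v x =
    √(v : ℝ) * Real.exp (x * ((1 - v) * x - 2 * μ) / (2 * v) + μ ^ 2 / (2 * v)) := by
  have hv' : (v : ℝ) ≠ 0 := by exact_mod_cast hv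
  rw [pdfRatio]
  congr 2
  field_simp
  ring

theorem tendsto_pdfRatio_atTop (hv : v ≠ 0) {l : Filter ℝ}
    (h : Tendsto (fun x : ℝ => x * ((1 - v) * x - 2 * μ)) l atTop) :
    Tendsto (pdfRatio μ v) l atTop := by
  have hv' : (0 : ℝ) < v := NNReal.coe_pos.2 (pos_iff_ne_zero.2 hv)
  simp_rw [funext (pdfRatio_eq (μ := μ) hv)]
  exact (Real.tendsto_exp_atTop.comp (tendsto_atTop_add_const_right _ _
    (h.atTop_div_const (by positivity)))).const_mul_atTop (Real.sqrt_pos.2 hv')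

theorem tendsto_pdfRatio_zero (hv : v ≠ 0) {l : Filter ℝ}
    (h : Tendsto (fun x : ℝ => x * ((1 - v) * x - 2 * μ)) l atBot) :
    Tendsto (pdfRatio μ v) l (𝓝 0) := by
  have hv' : (0 : ℝ) < v := NNReal.coe_pos.2 (pos_iff_ne_zero.2 hv)
  simp_rw [funext (pdfRatio_eq (μ := μ) hv)]
  simpa using (Real.tendsto_exp_atBot.comp (tendsto_atBot_add_const_right _ (μ ^ 2 / (2 * v))
    (h.atBot_div_const (by positivity : (0 : ℝ) < 2 * v)))).const_mul √(v : ℝ)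

theorem tendsto_pdfRatio_atBot_of_lt_one (hv : v ≠ 0) (hv1 : v < 1) :
    Tendsto (pdfRatio μ v) atBot atTop := by
  have h1 : (0 : ℝ) < 1 - v := sub_pos.2 (by exact_mod_cast hv1)
  refine tendsto_pdfRatio_atTop hv (tendsto_id.atBot_mul_atBot₀ ?_)
  exact tendsto_atBot_add_const_right _ _ (tendsto_id.const_mul_atBot h1)

theorem tendsto_pdfRatio_atBot_one (hμ : 0 < μ) : Tendsto (pdfRatio μ 1) atBot atTop := by
  refine tendsto_pdfRatio_atTop one_ne_zero ?_
  simpa using tendsto_id.atBot_mul_const_of_neg (show -(2 * μ) < 0 by linarith)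

theorem tendsto_pdfRatio_atBot_of_one_lt (hv1 : 1 < v) : Tendsto (pdfRatio μ v) atBot (𝓝 0) := by
  have h1 : (1 : ℝ) - v < 0 := sub_neg.2 (by exact_mod_cast hv1)
  refine tendsto_pdfRatio_zero (zero_lt_one.trans hv1).ne' (tendsto_id.atBot_mul_atTop₀ ?_)
  exact tendsto_atTop_add_const_right _ _ (tendsto_id.const_mul_atBot_of_neg h1)

theorem tendsto_pdfRatio_atTop_of_one_lt (hv1 : 1 < v) : Tendsto (pdfRatio μ v) atTop (𝓝 0) := by
  have h1 : (1 : ℝ) - v < 0 := sub_neg.2 (by exact_mod_cast hv1)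
  refine tendsto_pdfRatio_zero (zero_lt_one.trans hv1).ne' (tendsto_id.atTop_mul_atBot₀ ?_)
  exact tendsto_atBot_add_const_right _ _ (tendsto_id.const_mul_atTop_of_neg h1)

theorem tendsto_tailGap_atBot_of_one_lt (hv1 : 1 < v) (c : ℝ) :
    Tendsto (tailGap μ v c) atBot (𝓝 1) := by
  have h := ((tendsto_normalCDF_atBot 0 1).const_sub 1).sub
    ((tendsto_pdfRatio_atBot_of_one_lt (μ := μ) hv1).mul
      ((tendsto_normalCDF_atBot μ v).const_sub c))
  rwa [zero_mul, sub_zero, sub_zero] at h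

theorem tendsto_tailGap_atTop_of_one_lt (hv1 : 1 < v) (c : ℝ) :
    Tendsto (tailGap μ v c) atTop (𝓝 0) := by
  have h := ((tendsto_normalCDF_atTop 0 1).const_sub 1).sub
    ((tendsto_pdfRatio_atTop_of_one_lt (μ := μ) hv1).mul
      ((tendsto_normalCDF_atTop μ v).const_sub c))
  rwa [zero_mul, sub_zero, sub_self] at h

theorem tailGap_self_pos (s : ℝ) : 0 < tailGap μ v (normalCDF μ v s) s := by
  rw [tailGap, sub_self, mul_zero, sub_zero]
  exact sub_pos.2 (stdCDF_lt_one s)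

/-! ### The cases v < 1 and v = 1. -/

/-- Unique solvability of the equation for `β` and the value of `Z`, when `N / N_{μ,v}` decreases
from `∞` on `(-∞, b)`. -/
theorem exists_beta_of_decreasing (hv : v ≠ 0) {s b : ℝ} (hbs : b ≤ s)
    (htop : Tendsto (pdfRatio μ v) atBot atTop) (hdec : ∀ x < b, (1 - v) * x - μ < 0)
    (hpos : ∀ x, b ≤ x → x ≤ s → 0 < tailGap μ v (normalCDF μ v s) x) :
    ∃ β : ℝ, (∀ x : ℝ, BetaEquation μ v s x ↔ x = β) ∧
      rayleighNormal v s μ =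
        1 - (√(1 - stdCDF β) * √(normalCDF μ v s - normalCDF μ v β) + overlap μ v β) ^ 2 := by
  have hQ := strictMono_normalCDF μ hv
  have hmono : StrictMonoOn (tailGap μ v (normalCDF μ v s)) (Iic b) := by
    refine strictMonoOn_tailGap hv (convex_Iic b) fun x hx => ?_
    rw [interior_Iic] at hx
    exact mul_neg_of_neg_of_pos (hdec x hx) (sub_pos.2 (hQ (lt_of_lt_of_le hx hbs)))
  -- As x → -∞, r → ∞ while its factor tends to Φ_{μ,v}(s) > 0.
  have hlim : Tendsto (tailGap μ v (normalCDF μ v s)) atBot atBot := by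
    have h1 := htop.atTop_mul_pos (C := normalCDF μ v s) (normalCDF_pos μ hv s)
      (by simpa using (tendsto_normalCDF_atBot μ v).const_sub (normalCDF μ v s))
    have h2 := ((tendsto_normalCDF_atBot 0 1).const_sub 1).add_atBot
      (tendsto_neg_atTop_atBot.comp h1)
    exact h2.congr fun x => (sub_eq_add_neg _ _).symm
  obtain ⟨a, ha, hab⟩ := ((hlim.eventually_lt_atBot 0).and (eventually_le_atBot b)).exists
  obtain ⟨β, ⟨-, hβb⟩, hβ⟩ := intermediate_value_Icc hab
    (continuous_tailGap hv (normalCDF μ v s)).continuousOn ⟨ha.le, (hpos b le_rfl hbs).le⟩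
  have hβb : β < b := hβb.lt_of_ne fun h => (hpos b le_rfl hbs).ne' (h ▸ hβ)
  refine ⟨β, fun x => ?_, rayleighNormal_eq_of_beta hv (hβb.trans_le hbs) hβ (fun y hy hys => ?_)
    fun x hx => (hdec x (hx.trans_lt hβb)).le⟩
  · rw [betaEquation_iff hv]
    refine ⟨fun ⟨hxs, hx⟩ => ?_, fun hx => hx ▸ ⟨hβb.trans_le hbs, hβ⟩⟩
    have hxb : x < b := not_le.1 fun h => (hpos x h hxs.le).ne' hx
    exact hmono.injOn hxb.le hβb.le (hx.trans hβ.symm)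
  · rcases le_total b y with h | h
    · exact (hpos y h hys.le).le
    · exact hβ.symm.le.trans (hmono hβb.le h hy).le

/-- r decreases up to μ/(1-v) and then increases. Past that point the gap decreases to its positive
value 1 - Φ(s) at s, so no root occurs there; if s comes first, only the decreasing range matters.
-/
theorem exists_beta_of_lt_one (hv : v ≠ 0) (hv1 : v < 1) (s : ℝ) :
    ∃ β : ℝ, (∀ x : ℝ, BetaEquation μ v s x ↔ x = β) ∧
      rayleighNormal v s μ =
        1 - (√(1 - stdCDF β) * √(normalCDF μ v s - normalCDF μ v β) + overlap μ v β) ^ 2 := by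
  have h1 : (0 : ℝ) < 1 - v := sub_pos.2 (by exact_mod_cast hv1)
  refine exists_beta_of_decreasing hv (min_le_right (μ / (1 - v)) s)
    (tendsto_pdfRatio_atBot_of_lt_one hv hv1) (fun x hx => ?_) fun x hx hxs => ?_
  · have := (lt_div_iff₀ h1).1 (hx.trans_le (min_le_left _ _))
    linarith
  · rcases min_le_iff.1 hx with h | h
    · have hanti : StrictAntiOn (tailGap μ v (normalCDF μ v s)) (Icc (μ / (1 - v)) s) := by
        refine strictAntiOn_tailGap hv (convex_Icc _ _) fun y hy => ?_
        rw [interior_Icc] at hy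
        have := (div_lt_iff₀ h1).1 hy.1
        exact mul_pos (by linarith) (sub_pos.2 (strictMono_normalCDF μ hv hy.2))
      exact (tailGap_self_pos s).trans_le
        (hanti.antitoneOn ⟨h, hxs⟩ ⟨h.trans hxs, le_rfl⟩ hxs)
    · rw [le_antisymm hxs h]
      exact tailGap_self_pos s

theorem overlap_one (μ x : ℝ) :
    overlap μ 1 x = stdCDF (x - μ / 2) * Real.exp (-(μ ^ 2 / 8)) := by
  have h : (2 : ℝ≥0) * 1 / (1 + 1) = 1 := by
    rw [mul_one, one_add_one_eq_two, div_self two_ne_zero]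
  rw [overlap, h, normalCDF_eq_stdCDF_sub, NNReal.coe_one, Real.sqrt_one,
    show (2 : ℝ) * 1 / (1 + 1) = 1 by norm_num, Real.sqrt_one, one_mul, mul_comm,
    show (1 : ℝ) + 1 = 2 by norm_num, show (4 : ℝ) * 2 = 8 by norm_num]

theorem exists_beta_one (hμ : 0 < μ) (s : ℝ) :
    ∃ β : ℝ, (∀ x : ℝ, BetaEquation μ 1 s x ↔ x = β) ∧
      rayleighNormal 1 s μ =
        1 - (√(1 - stdCDF β) * √(stdCDF (s - μ) - stdCDF (β - μ))
          + stdCDF (β - μ / 2) * Real.exp (-(μ ^ 2 / 8))) ^ 2 := by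
  obtain ⟨β, h1, h2⟩ := exists_beta_of_decreasing one_ne_zero (le_refl s)
    (tendsto_pdfRatio_atBot_one hμ) (fun x _ => by simpa using hμ)
    fun x h h' => by
      rw [le_antisymm h' h]
      exact tailGap_self_pos s
  refine ⟨β, h1, ?_⟩
  rw [h2, overlap_one, normalCDF_eq_stdCDF_sub, normalCDF_eq_stdCDF_sub]

/-- A shift to the left raises the distribution function, so Φ_{μ,1} ≥ Φ and the constant weight is
optimal. -/
theorem rayleighNormal_one_of_nonpos (hμ : μ ≤ 0) (s : ℝ) :
    rayleighNormal 1 s μ = stdCDF (μ - s) := by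
  rw [rayleighNormal_eq_of_dominated one_ne_zero fun x _ => ?_, normalCDF_eq_stdCDF_sub,
    ← stdCDF_neg, neg_sub]
  calc stdCDF x * normalCDF μ 1 s ≤ stdCDF x :=
        mul_le_of_le_one_right (stdCDF_pos x).le (normalCDF_lt_one μ one_ne_zero s).le
    _ ≤ normalCDF μ 1 x := by
        rw [normalCDF_eq_stdCDF_sub]
        exact (strictMono_normalCDF 0 one_ne_zero).monotone (by linarith)

/-! ### The case v > 1: α, τ and the two roots. -/

/-- For `v > 1`, the crossing point `α` lies to the right of the mode `μ / (1 - v)` of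
`N / N_{μ,v}`. -/
theorem exists_alpha (hv1 : 1 < v) : ∃ α : ℝ, μ / (1 - v) < α ∧
    tailGap μ v 0 α = 1 ∧ (∀ y < α, 1 < tailGap μ v 0 y) ∧ (∀ y, α < y → tailGap μ v 0 y < 1) := by
  have hv : v ≠ 0 := (zero_lt_one.trans hv1).ne'
  have h1 : (1 : ℝ) - v < 0 := sub_neg.2 (by exact_mod_cast hv1)
  have hmono : StrictMonoOn (tailGap μ v 0) (Iic (μ / (1 - v))) := by
    refine strictMonoOn_tailGap hv (convex_Iic _) fun x hx => ?_
    rw [interior_Iic] at hx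
    have := (lt_div_iff_of_neg h1).1 hx
    exact mul_neg_of_pos_of_neg (by linarith) (sub_neg.2 (normalCDF_pos μ hv x))
  have hanti : StrictAntiOn (tailGap μ v 0) (Ici (μ / (1 - v))) := by
    refine strictAntiOn_tailGap hv (convex_Ici _) fun x hx => ?_
    rw [interior_Ici] at hx
    have := (div_lt_iff_of_neg h1).1 hx
    exact mul_pos_of_neg_of_neg (by linarith) (sub_neg.2 (normalCDF_pos μ hv x))
  have hleft : ∀ x ≤ μ / (1 - v), 1 < tailGap μ v 0 x := fun x hx => by
    -- The limit 1 at -∞ gives only a weak inequality; the step from x - 1 to x makes it strict.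
    have h2 : 1 ≤ tailGap μ v 0 (x - 1) := by
      refine le_of_tendsto (tendsto_tailGap_atBot_of_one_lt (μ := μ) hv1 0) ?_
      filter_upwards [eventually_le_atBot (x - 1)] with y hy
      have hx1 : x - 1 ≤ μ / (1 - v) := by linarith
      exact hmono.monotoneOn (hy.trans hx1) hx1 hy
    exact h2.trans_lt (hmono (show x - 1 ≤ _ by linarith) hx (by linarith))
  obtain ⟨b, hb, hmb⟩ := (((tendsto_tailGap_atTop_of_one_lt hv1 0).eventually_lt_const
    zero_lt_one).and (eventually_ge_atTop (μ / (1 - v)))).exists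
  obtain ⟨α, ⟨hmα, -⟩, hα⟩ := intermediate_value_Icc' hmb
    (continuous_tailGap (μ := μ) hv 0).continuousOn ⟨hb.le, (hleft _ le_rfl).le⟩
  have hmα' : μ / (1 - v) < α := hmα.lt_of_ne fun h => (hleft α h.ge).ne' hα
  refine ⟨α, hmα', hα, fun y hy => ?_, fun y hy => ?_⟩
  · rcases le_total y (μ / (1 - v)) with h | h
    · exact hleft y h
    · exact hα.symm.trans_lt (hanti h hmα hy)
  · exact (hanti hmα (hmα.trans hy.le) hy).trans_eq hα

/-- Beyond the mode of r the gap with c = 1 increases strictly to its limit 0. At α its value is 1 -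
r(α), so r(α) > 1, which is what makes τ exist. -/
theorem tailGap_one_neg (hv1 : 1 < v) {x : ℝ} (hx : μ / (1 - v) ≤ x) : tailGap μ v 1 x < 0 := by
  have hv : v ≠ 0 := (zero_lt_one.trans hv1).ne'
  have h1 : (1 : ℝ) - v < 0 := sub_neg.2 (by exact_mod_cast hv1)
  have hmono : StrictMonoOn (tailGap μ v 1) (Ici (μ / (1 - v))) := by
    refine strictMonoOn_tailGap hv (convex_Ici _) fun x hx => ?_
    rw [interior_Ici] at hx
    have := (div_lt_iff_of_neg h1).1 hx
    exact mul_neg_of_neg_of_pos (by linarith) (sub_pos.2 (normalCDF_lt_one μ hv x))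
  have hx1 : μ / (1 - v) ≤ x + 1 := by linarith
  refine (hmono hx hx1 (lt_add_one x)).trans_le
    (ge_of_tendsto (tendsto_tailGap_atTop_of_one_lt (μ := μ) hv1 1) ?_)
  filter_upwards [eventually_ge_atTop (x + 1)] with y hy
  exact hmono.monotoneOn hx1 (hx1.trans hy) hy

/-- The maximum of Φ/Φ_{μ,v} is r(α), so Φ_{μ,v}/Φ_{μ,v}(s) dominates Φ exactly when r(α) Φ_{μ,v}(s)
≤ 1, that is s ≤ τ. For s > τ the gap is negative at α, which forces one root on each side of α. -/
theorem exists_alpha_tau (hv1 : 1 < v) : ∃ α τ : ℝ,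
    (∀ x : ℝ, AlphaEquation μ v x ↔ x = α) ∧
    (∀ t : ℝ, normalCDF μ v t = normalCDF μ v α / stdCDF α ↔ t = τ) ∧
    (∀ s : ℝ, s ≤ τ → rayleighNormal v s μ = 1 - normalCDF μ v s) ∧
    (∀ s : ℝ, τ < s → ∃ β' β : ℝ, β' < β ∧ β' ≤ α ∧ α < β ∧
      (∀ x : ℝ, BetaEquation μ v s x ↔ x = β' ∨ x = β) ∧
      rayleighNormal v s μ =
        1 - (√(stdCDF α * normalCDF μ v α) + overlap μ v β - overlap μ v α
          + √(1 - stdCDF β) * √(normalCDF μ v s - normalCDF μ v β)) ^ 2) := by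
  have hv : v ≠ 0 := (zero_lt_one.trans hv1).ne'
  have h1 : (1 : ℝ) - v < 0 := sub_neg.2 (by exact_mod_cast hv1)
  have hQmono := strictMono_normalCDF μ hv
  obtain ⟨α, hmα, hα, hαl, hαr⟩ := exists_alpha (μ := μ) hv1
  have hr := pdfRatio_pos (μ := μ) hv α
  have hQ := normalCDF_pos μ hv α
  have hP := stdCDF_pos α
  have hPQ : stdCDF α = pdfRatio μ v α * normalCDF μ v α := by
    rw [tailGap] at hα
    linarith
  have hr1 : 1 < pdfRatio μ v α := by
    have h := tailGap_one_neg hv1 hmα.le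
    rw [tailGap] at h
    linarith
  have hquot : normalCDF μ v α / stdCDF α = (pdfRatio μ v α)⁻¹ := by
    rw [hPQ]
    field_simp
  have hαQ : normalCDF μ v α < normalCDF μ v α / stdCDF α := by
    rw [lt_div_iff₀ hP]
    exact mul_lt_of_lt_one_right hQ (stdCDF_lt_one α)
  obtain ⟨b, hb, hαb⟩ := (((tendsto_normalCDF_atTop μ v).eventually_const_lt
    (hquot.trans_lt (inv_lt_one_of_one_lt₀ hr1))).and (eventually_ge_atTop α)).exists
  obtain ⟨τ, -, hτ⟩ := intermediate_value_Icc hαb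
    (continuous_normalCDF μ hv).continuousOn ⟨hαQ.le, hb.le⟩
  have hατ : α < τ := hQmono.lt_iff_lt.1 (hτ ▸ hαQ)
  refine ⟨α, τ, fun x => ?_, fun t => ?_, fun s hs => ?_, fun s hs => ?_⟩
  · rw [alphaEquation_iff hv]
    refine ⟨fun hx => ?_, fun hx => hx ▸ hα⟩
    rcases lt_trichotomy x α with h | h | h
    · exact absurd hx (hαl x h).ne'
    · exact h
    · exact absurd hx (hαr x h).ne
  · rw [← hτ]
    exact hQmono.injective.eq_iff
  · refine rayleighNormal_eq_of_dominated hv fun x _ => ?_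
    have h2 : stdCDF x / normalCDF μ v x ≤ stdCDF α / normalCDF μ v α := by
      rcases le_total x α with h | h
      · exact stdCDF_div_le_of_le hv (fun y hy => (hαl y hy).le) h
      · exact stdCDF_div_le_of_ge hv (fun y hy => (hαr y hy).le) h
    rw [div_le_iff₀ (normalCDF_pos μ hv x), hPQ, mul_div_cancel_right₀ _ hQ.ne'] at h2
    have h3 : normalCDF μ v s ≤ (pdfRatio μ v α)⁻¹ := by
      rw [← hquot, ← hτ]
      exact hQmono.monotone hs
    calc stdCDF x * normalCDF μ v s
        ≤ (pdfRatio μ v α * normalCDF μ v x) * (pdfRatio μ v α)⁻¹ := by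
          have := normalCDF_pos μ hv x
          have := normalCDF_pos μ hv s
          gcongr
      _ = normalCDF μ v x := by field_simp
  · have hαs := hατ.trans hs
    have hanti : StrictAntiOn (tailGap μ v (normalCDF μ v s)) (Iic (μ / (1 - v))) := by
      refine strictAntiOn_tailGap hv (convex_Iic _) fun x hx => ?_
      rw [interior_Iic] at hx
      have := (lt_div_iff_of_neg h1).1 hx
      exact mul_pos (by linarith) (sub_pos.2 (hQmono (hx.trans (hmα.trans hαs))))
    have hmono : StrictMonoOn (tailGap μ v (normalCDF μ v s)) (Icc (μ / (1 - v)) s) := by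
      refine strictMonoOn_tailGap hv (convex_Icc _ _) fun x hx => ?_
      rw [interior_Icc] at hx
      have := (div_lt_iff_of_neg h1).1 hx.1
      exact mul_neg_of_neg_of_pos (by linarith) (sub_pos.2 (hQmono hx.2))
    -- By the equation for α, this gap equals 1 - r(α) Φ_{μ,v}(s).
    have hGα : tailGap μ v (normalCDF μ v s) α < 0 := by
      have h2 : (pdfRatio μ v α)⁻¹ < normalCDF μ v s := by
        rw [← hquot, ← hτ]
        exact hQmono hs
      rw [inv_lt_iff_one_lt_mul₀' hr] at h2
      rw [tailGap, hPQ]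
      linarith
    have hαI : α ∈ Icc (μ / (1 - v)) s := ⟨hmα.le, hαs.le⟩
    have hGm : tailGap μ v (normalCDF μ v s) (μ / (1 - v)) < 0 :=
      (hmono ⟨le_rfl, (hmα.trans hαs).le⟩ hαI hmα).trans hGα
    have hcont := continuous_tailGap (μ := μ) hv (normalCDF μ v s)
    obtain ⟨a, ha, ham⟩ := (((tendsto_tailGap_atBot_of_one_lt hv1
      (normalCDF μ v s)).eventually_const_lt zero_lt_one).and
        (eventually_le_atBot (μ / (1 - v)))).exists
    -- The spurious root: the gap falls from its limit 1 at -∞ to a negative value at the mode of r.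
    obtain ⟨β', ⟨-, hβ'm⟩, hβ'⟩ := intermediate_value_Icc' ham hcont.continuousOn
      ⟨hGm.le, ha.le⟩
    obtain ⟨β, ⟨hαβ, hβs⟩, hβ⟩ := intermediate_value_Icc hαs.le hcont.continuousOn
      ⟨hGα.le, (tailGap_self_pos s).le⟩
    have hαβ : α < β := hαβ.lt_of_ne fun h => hGα.ne (h ▸ hβ)
    have hβs : β < s := hβs.lt_of_ne fun h => (tailGap_self_pos s).ne' (h ▸ hβ)
    have hβI : β ∈ Icc (μ / (1 - v)) s := ⟨(hmα.trans hαβ).le, hβs.le⟩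
    refine ⟨β', β, (hβ'm.trans_lt hmα).trans hαβ, hβ'm.trans hmα.le, hαβ, fun x => ?_,
      rayleighNormal_eq_of_alpha_beta hv hαβ hβs hα (fun y hy => (hαl y hy).le) hβ
        (fun y hy hys => ?_) fun x hx => ?_⟩
    · rw [betaEquation_iff hv]
      constructor
      · rintro ⟨hxs, hx⟩
        rcases le_total x (μ / (1 - v)) with h | h
        · exact Or.inl (hanti.injOn h hβ'm (hx.trans hβ'.symm))
        · exact Or.inr (hmono.injOn ⟨h, hxs.le⟩ hβI (hx.trans hβ.symm))
      · rintro (rfl | rfl)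
        · exact ⟨hβ'm.trans_lt (hmα.trans hαs), hβ'⟩
        · exact ⟨hβs, hβ⟩
    · exact hβ.symm.le.trans (hmono hβI ⟨hβI.1.trans hy.le, hys.le⟩ hy).le
    · have := (div_le_iff_of_neg h1).1 (hmα.le.trans hx.1)
      linarith

end

theorem theorem1 (μ : ℝ) :
    -- the case `0 < v < 1`
    (∀ v : ℝ≥0, 0 < v → v < 1 → ∀ s : ℝ, ∃ β : ℝ,
      (∀ x : ℝ, BetaEquation μ v s x ↔ x = β) ∧
      rayleighNormal v s μ =
        1 - (√(1 - stdCDF β) * √(normalCDF μ v s - normalCDF μ v β) + overlap μ v β) ^ 2) ∧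
    -- the case `v = 1`, `μ ≤ 0`
    (μ ≤ 0 → ∀ s : ℝ, rayleighNormal 1 s μ = stdCDF (μ - s)) ∧
    -- the case `v = 1`, `μ > 0`
    (0 < μ → ∀ s : ℝ, ∃ β : ℝ,
      (∀ x : ℝ, BetaEquation μ 1 s x ↔ x = β) ∧
      rayleighNormal 1 s μ =
        1 - (√(1 - stdCDF β) * √(stdCDF (s - μ) - stdCDF (β - μ))
          + stdCDF (β - μ / 2) * Real.exp (-(μ ^ 2 / 8))) ^ 2) ∧
    -- the case `v > 1`; here `τ = Φ_{μ,v}⁻¹(Φ_{μ,v}(α) / Φ(α))`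
    (∀ v : ℝ≥0, 1 < v → ∃ α τ : ℝ,
      (∀ x : ℝ, AlphaEquation μ v x ↔ x = α) ∧
      (∀ t : ℝ, normalCDF μ v t = normalCDF μ v α / stdCDF α ↔ t = τ) ∧
      (∀ s : ℝ, s ≤ τ → rayleighNormal v s μ = 1 - normalCDF μ v s) ∧
      (∀ s : ℝ, τ < s → ∃ β' β : ℝ, β' < β ∧ β' ≤ α ∧ α < β ∧
        (∀ x : ℝ, BetaEquation μ v s x ↔ x = β' ∨ x = β) ∧
        rayleighNormal v s μ =
          1 - (√(stdCDF α * normalCDF μ v α) + overlap μ v β - overlap μ v α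
            + √(1 - stdCDF β) * √(normalCDF μ v s - normalCDF μ v β)) ^ 2)) ∧
    -- the value `I_{μ,v}(∞)`
    (∀ v : ℝ≥0, 0 < v →
      Filter.Tendsto (overlap μ v) Filter.atTop
        (nhds (√(2 * √(v : ℝ) / (1 + v)) * Real.exp (-(μ ^ 2 / (4 * (1 + v))))))) := by
  refine ⟨fun v hv hv1 s => exists_beta_of_lt_one hv.ne' hv1 s, rayleighNormal_one_of_nonpos,
    exists_beta_one, fun v hv1 => exists_alpha_tau hv1, fun v _ => tendsto_overlap μ v⟩
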